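/- For $n\ge 0$ let $\mathcal I_n(321)$ be the set of permutations $\pi$ of $\{1,\dots,n\}$ with $\pi=\pi^{-1}$ that avoid the pattern $321$ (there are no $i<j<k$ with $\pi(i)>\pi(j)>\pi(k)$). Let $\operatorname{fp}(\pi)$ be the number of $i$ with $\pi(i)=i$, and let $\operatorname{maj}(\pi)$ be the sum of all $i$ with $1\le i<n$ and $\pi(i)>\pi(i+1)$. Let $\binom{n}{k}_q$ denote the $q$-binomial coefficient, a polynomial in $q$, with $\binom{n}{k}_q=0$ if $k<0$ or $k>n$. For all integers $b\ge a\ge 0$, $$\sum_{\substack{\pi\in\mathcal I_{a+b}(321)\\ \operatorname{fp}(\pi)\ge b-a}} q^{\operatorname{maj}(\pi)}=\binom{a+b}{a}_q.$$ Consequently, for all integers $n,\ell\ge 0$ with $\ell\equiv n \pmod 2$, $$\sum_{\substack{\pi\in\mathcal I_{n}(321)\\ \operatorname{fp}(\pi)=\ell}} q^{\operatorname{maj}(\pi)}=\binom{n}{\frac{n-\ell}{2}}_q-\binom{n}{\frac{n-\ell}{2}-1}_q.$$ -/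

import Mathlib

namespace PermStat

/-- The permutation `π` of an `m`-element chain contains the pattern `τ`: some subsequence of
`π`, taken at increasing positions, is in the same relative order as `τ`. -/
def ContainsPattern {m k : ℕ} (π : Equiv.Perm (Fin m)) (τ : Equiv.Perm (Fin k)) : Prop :=
  ∃ f : Fin k → Fin m, StrictMono f ∧ ∀ s t : Fin k, π (f s) < π (f t) ↔ τ s < τ t

/-- Pattern avoidance. -/
def AvoidsPattern {m k : ℕ} (π : Equiv.Perm (Fin m)) (τ : Equiv.Perm (Fin k)) : Prop :=
  ¬ ContainsPattern π τ

/-- The pattern `321`, i.e. the order-reversing permutation of three letters. -/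
def pattern321 : Equiv.Perm (Fin 3) := Fin.revPerm

open Classical in
/-- The finite set of `321`-avoiding involutions (the identity included) in the symmetric group
on `m` letters. -/
noncomputable def involutions321 (m : ℕ) : Finset (Equiv.Perm (Fin m)) :=
  Finset.univ.filter fun π => Function.Involutive π ∧ AvoidsPattern π pattern321

/-- Descent positions, numbered from `1` to `m - 1`: `p` is a descent if `π(p) > π(p+1)` in
one-based notation. In the zero-based indexing of `Fin m`, the letters `p` and `p + 1` are the
elements `i` and `j` with values `p - 1` and `p`. -/
def descents {m : ℕ} (π : Equiv.Perm (Fin m)) : Finset ℕ :=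
  (Finset.Ico 1 m).filter fun p =>
    ∃ i j : Fin m, (i : ℕ) + 1 = p ∧ (j : ℕ) = p ∧ π j < π i

/-- The major index: the sum of the descent positions. -/
def maj {m : ℕ} (π : Equiv.Perm (Fin m)) : ℕ := ∑ p ∈ descents π, p

/-- The number of fixed points. -/
def fp {m : ℕ} (π : Equiv.Perm (Fin m)) : ℕ :=
  (Finset.univ.filter fun i : Fin m => π i = i).card

/-- The `q`-integer `1 + q + ⋯ + q ^ (n - 1)`, where `q` is the polynomial variable. -/
noncomputable def qInt (n : ℕ) : Polynomial ℤ := ∑ i ∈ Finset.range n, Polynomial.X ^ i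

/-- The `q`-factorial. -/
noncomputable def qFactorial (n : ℕ) : Polynomial ℤ := ∏ i ∈ Finset.range n, qInt (i + 1)

/-- The `q`-binomial coefficient (Gaussian polynomial) in `ℤ[q]`, by the `q`-Pascal rule. It is
the quotient of `q`-factorials by `qBinom_mul` below, and it vanishes when `k > n`. -/
noncomputable def qBinom : ℕ → ℕ → Polynomial ℤ
  | _, 0 => 1
  | 0, _ + 1 => 0
  | n + 1, k + 1 => qBinom n k + Polynomial.X ^ (k + 1) * qBinom n (k + 1)

theorem qBinom_eq_zero : ∀ {n k : ℕ}, n < k → qBinom n k = 0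
  | 0, k + 1, _ => by simp [qBinom]
  | n + 1, k + 1, h => by
    rw [qBinom, qBinom_eq_zero (show n < k by omega), qBinom_eq_zero (show n < k + 1 by omega)]
    simp

theorem qInt_add (a b : ℕ) : qInt (a + b) = qInt a + Polynomial.X ^ a * qInt b := by
  simp [qInt, Finset.sum_range_add, pow_add, Finset.mul_sum]

theorem qFactorial_succ (n : ℕ) : qFactorial (n + 1) = qFactorial n * qInt (n + 1) := by
  simp [qFactorial, Finset.prod_range_succ]

/-- `[n choose k]_q = [n]_q! / ([k]_q! [n - k]_q!)` for `k ≤ n`, here with `n = k + j`. -/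
theorem qBinom_mul : ∀ k j : ℕ,
    qBinom (k + j) k * (qFactorial k * qFactorial j) = qFactorial (k + j)
  | 0, j => by simp [qBinom, qFactorial]
  | k + 1, 0 => by
    have h := qBinom_mul k 0
    simp only [add_zero] at h ⊢
    rw [qBinom, qBinom_eq_zero (Nat.lt_succ_self k), qFactorial_succ]
    linear_combination qInt (k + 1) * h
  | k + 1, j + 1 => by
    have h1 := qBinom_mul k (j + 1)
    have h2 := qBinom_mul (k + 1) j
    have e : k + 1 + j = k + (j + 1) := by omega
    have e' : k + 1 + (j + 1) = (k + (j + 1)) + 1 := by omega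
    rw [e] at h2
    rw [e', qBinom, qFactorial_succ (k + (j + 1))]
    have h3 := qInt_add (k + 1) (j + 1)
    rw [e'] at h3
    rw [h3, qFactorial_succ k, qFactorial_succ j]
    rw [qFactorial_succ j] at h1
    rw [qFactorial_succ k] at h2
    linear_combination qInt (k + 1) * h1 + Polynomial.X ^ (k + 1) * qInt (j + 1) * h2

/-- The `q`-binomial coefficient with an integer lower index; it is `0` when that index is
negative. -/
noncomputable def qBinomInt (n : ℕ) : ℤ → Polynomial ℤ
  | Int.ofNat k => qBinom n k
  | Int.negSucc _ => 0

end PermStat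

open Finset

namespace PermStat

/-! ### Three-term recurrence for `q`-binomial coefficients and their differences -/

section QBinomial

open Polynomial

/-! A 321-avoiding involution is one whose arcs are non-nested with no fixed point under an arc
(`mem_involutions321`). It is determined by its set of deficiencies, and the sets that arise are
exactly the ballot sets (`NonNested.ext_of_deficiency`, `exists_matching`). Its descents are the
deficiencies preceded by a non-deficiency, so `maj` depends only on that set
(`setMaj_deficiencies`), and `fp` is `n` minus twice its size.

Ballot sets of size `k` are then counted by `setMaj`: their generating function and `qBinomDiff n k`
satisfy the same three-term recurrence and agree on the boundary (`ballotGF_eq_qBinomDiff`). This is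
the formula for a fixed number of fixed points; summing over `k ≤ a` telescopes to the first
identity. -/

theorem qInt_mul_one_sub (n : ℕ) : qInt n * (1 - X) = 1 - X ^ n := by
  have h := geom_sum_mul (X : ℤ[X]) n
  rw [qInt]
  linear_combination -h

theorem qFactorial_ne_zero (n : ℕ) : qFactorial n ≠ 0 := by
  have h : (qFactorial n).eval 1 ≠ 0 := by
    simp only [qFactorial, qInt, eval_prod, eval_finsetSum, eval_pow, eval_X, one_pow]
    rw [Finset.prod_ne_zero_iff]
    intro i _
    simp
    omega
  rintro h0
  simp [h0] at h

theorem qBinom_symm_add (k j : ℕ) : qBinom (k + j) k = qBinom (k + j) j := by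
  have h1 := qBinom_mul k j
  have h2 := qBinom_mul j k
  rw [add_comm j k] at h2
  refine mul_right_cancel₀ (mul_ne_zero (qFactorial_ne_zero k) (qFactorial_ne_zero j)) ?_
  linear_combination h1 - h2

theorem qBinom_absorb (n k : ℕ) :
    (1 - X ^ (k + 1)) * qBinom (n + 1) (k + 1) = (1 - X ^ (n + 1)) * qBinom n k := by
  rcases lt_or_ge n k with h | h
  · simp [qBinom_eq_zero h, qBinom_eq_zero (show n + 1 < k + 1 by omega)]
  · obtain ⟨j, rfl⟩ := Nat.exists_eq_add_of_le h
    have h1 := qBinom_mul (k + 1) j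
    have h2 := qBinom_mul k j
    rw [show k + 1 + j = k + j + 1 by omega, qFactorial_succ, qFactorial_succ] at h1
    rw [← qInt_mul_one_sub, ← qInt_mul_one_sub]
    refine mul_right_cancel₀ (mul_ne_zero (qFactorial_ne_zero k) (qFactorial_ne_zero j)) ?_
    linear_combination (1 - X) * h1 - (1 - X) * qInt (k + j + 1) * h2

/-- Pascal's rule, with `X ^ (k + 1)` eliminated by absorption. No coefficient depends on `k` any
more, so differences in `k` inherit the recurrence. -/
theorem qBinom_three_term (n k : ℕ) :
    qBinom (n + 2) (k + 1)
      = qBinom (n + 1) (k + 1) + qBinom (n + 1) k + (X ^ (n + 1) - 1) * qBinom n k := by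
  have h := qBinom_absorb n k
  rw [qBinom]
  linear_combination -h

/-- The difference of two consecutive `q`-binomial coefficients. -/
noncomputable def qBinomDiff (n : ℕ) : ℕ → ℤ[X]
  | 0 => qBinom n 0
  | k + 1 => qBinom n (k + 1) - qBinom n k

theorem qBinomDiff_three_term (n k : ℕ) :
    qBinomDiff (n + 2) (k + 1) = qBinomDiff (n + 1) (k + 1) + qBinomDiff (n + 1) k
      + (X ^ (n + 1) - 1) * qBinomDiff n k := by
  cases k with
  | zero =>
    have h := qBinom_three_term n 0
    simp only [qBinomDiff, zero_add, qBinom] at h ⊢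
    linear_combination h
  | succ k =>
    have h := qBinom_three_term n k
    have h' := qBinom_three_term n (k + 1)
    simp only [qBinomDiff]
    linear_combination h' - h

theorem qBinomDiff_eq_zero (k : ℕ) : qBinomDiff (2 * k + 1) (k + 1) = 0 := by
  have h := qBinom_symm_add k (k + 1)
  rw [show k + (k + 1) = 2 * k + 1 by omega] at h
  rw [qBinomDiff, h, sub_self]

theorem sum_qBinomDiff (n a : ℕ) : ∑ k ∈ range (a + 1), qBinomDiff n k = qBinom n a := by
  induction a with
  | zero => simp [qBinomDiff]
  | succ a ih => rw [sum_range_succ, ih, qBinomDiff]; ring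

theorem qBinomInt_sub (n k : ℕ) :
    qBinomInt n (k : ℤ) - qBinomInt n ((k : ℤ) - 1) = qBinomDiff n k := by
  cases k with
  | zero =>
    change qBinom n 0 - 0 = _
    rw [sub_zero, qBinomDiff]
  | succ k =>
    rw [show ((k + 1 : ℕ) : ℤ) - 1 = (k : ℕ) by push_cast; ring]
    rfl

end QBinomial

/-! ### Counting ballot sets by major index -/

section Ballot

open Polynomial

/-- A set `S` of positions is ballot if the word with letter `D` at the positions in `S` and `U`
elsewhere has, in each prefix, at most as many `D`s as `U`s. -/
def Ballot (S : Finset ℕ) : Prop := ∀ j, 2 * #(S.filter (· < j)) ≤ j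

/-- The sum of the positions of the letters `D` preceded by a letter `U`. -/
def setMaj (S : Finset ℕ) : ℕ := ∑ p ∈ S.filter (fun p => p - 1 ∉ S), p

open Classical in
/-- The ballot sets of `k` positions among the first `n`. -/
noncomputable def ballotSets (n k : ℕ) : Finset (Finset ℕ) :=
  ((range n).powersetCard k).filter Ballot

theorem mem_ballotSets {n k : ℕ} {S : Finset ℕ} :
    S ∈ ballotSets n k ↔ S ⊆ range n ∧ #S = k ∧ Ballot S := by
  simp [ballotSets, mem_powersetCard, and_assoc]

/-- The major index generating function of ballot sets. -/
noncomputable def ballotGF (n k : ℕ) : ℤ[X] := ∑ S ∈ ballotSets n k, X ^ setMaj S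

theorem Ballot.two_mul_card_le {n : ℕ} {S : Finset ℕ} (h : Ballot S) (hS : S ⊆ range n) :
    2 * #S ≤ n := by
  have := h n
  rwa [filter_true_of_mem fun x hx => mem_range.1 (hS hx)] at this

theorem ballotSets_eq_empty {n k : ℕ} (h : n < 2 * k) : ballotSets n k = ∅ := by
  rw [eq_empty_iff_forall_notMem]
  intro S hS
  obtain ⟨h1, h2, h3⟩ := mem_ballotSets.1 hS
  have := h3.two_mul_card_le h1
  omega

theorem ballotGF_zero (n : ℕ) : ballotGF n 0 = 1 := by
  have : ballotSets n 0 = {∅} := by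
    ext S
    rw [mem_ballotSets, mem_singleton, card_eq_zero]
    constructor
    · exact fun h => h.2.1
    · rintro rfl
      simp [Ballot]
  simp [ballotGF, this, setMaj]

theorem ballot_insert_iff {n : ℕ} {S : Finset ℕ} (hS : S ⊆ range n) :
    Ballot (insert n S) ↔ Ballot S ∧ 2 * (#S + 1) ≤ n + 1 := by
  have hn : n ∉ S := fun h => by simpa using hS h
  constructor
  · intro h
    refine ⟨fun j => le_trans ?_ (h j), ?_⟩
    · gcongr
      exact subset_insert _ _
    · have := h.two_mul_card_le (n := n + 1) (by
        rw [range_add_one]; exact insert_subset_insert _ hS)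
      rwa [card_insert_of_notMem hn] at this
  · rintro ⟨h, h'⟩ j
    rcases le_or_gt j n with hj | hj
    · rw [filter_insert, if_neg (by omega)]
      exact h j
    · calc 2 * #((insert n S).filter (· < j)) ≤ 2 * #(insert n S) := by
            gcongr; exact filter_subset _ _
        _ ≤ j := by rw [card_insert_of_notMem hn]; omega

theorem setMaj_insert_of_mem {n : ℕ} {S : Finset ℕ} (hS : S ⊆ range (n + 1)) (hn : n ∈ S) :
    setMaj (insert (n + 1) S) = setMaj S := by
  rw [setMaj, setMaj, filter_insert, if_neg (by simp [hn])]
  refine sum_congr (filter_congr fun p hp => ?_) fun _ _ => rfl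
  have := mem_range.1 (hS hp)
  rw [mem_insert, not_or]
  exact and_iff_right (by omega)

theorem setMaj_insert_of_notMem {n : ℕ} {S : Finset ℕ} (hS : S ⊆ range (n + 1)) (hn : n ∉ S) :
    setMaj (insert (n + 1) S) = n + 1 + setMaj S := by
  have hn1 : n + 1 ∉ S := fun h => by simpa using hS h
  rw [setMaj, setMaj, filter_insert, if_pos (by simp [hn]),
    sum_insert (by simp [hn1])]
  congr 1
  refine sum_congr (filter_congr fun p hp => ?_) fun _ _ => rfl
  have := mem_range.1 (hS hp)
  rw [mem_insert, not_or]
  exact and_iff_right (by omega)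

theorem ballotSets_filter_notMem (n k : ℕ) :
    (ballotSets (n + 1) k).filter (fun S => n ∉ S) = ballotSets n k := by
  ext S
  simp only [mem_filter, mem_ballotSets]
  constructor
  · rintro ⟨⟨h1, h2⟩, h3⟩
    refine ⟨fun x hx => ?_, h2⟩
    have h4 := mem_range.1 (h1 hx)
    have : x ≠ n := by rintro rfl; exact h3 hx
    exact mem_range.2 (by omega)
  · rintro ⟨h1, h2⟩
    exact ⟨⟨h1.trans (range_mono (by omega)), h2⟩, fun h => by simpa using h1 h⟩

theorem ballotSets_filter_mem {n k : ℕ} (h : 2 * (k + 1) ≤ n + 1) :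
    (ballotSets (n + 1) (k + 1)).filter (fun S => n ∈ S)
      = (ballotSets n k).image (insert n) := by
  ext S
  simp only [mem_filter, mem_image, mem_ballotSets]
  constructor
  · rintro ⟨⟨h1, h2, h3⟩, h4⟩
    have hsub : S.erase n ⊆ range n := by
      intro x hx
      have h5 := mem_range.1 (h1 (mem_of_mem_erase hx))
      have := ne_of_mem_erase hx
      exact mem_range.2 (by omega)
    refine ⟨S.erase n, ⟨hsub, by rw [card_erase_of_mem h4, h2]; rfl, ?_⟩, insert_erase h4⟩
    rw [← insert_erase h4, ballot_insert_iff hsub] at h3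
    exact h3.1
  · rintro ⟨T, ⟨h1, h2, h3⟩, rfl⟩
    have hn : n ∉ T := fun h => by simpa using h1 h
    refine ⟨⟨?_, ?_, ?_⟩, mem_insert_self _ _⟩
    · rw [range_add_one]; exact insert_subset_insert _ h1
    · rw [card_insert_of_notMem hn, h2]
    · rw [ballot_insert_iff h1, h2]; exact ⟨h3, h⟩

/-- Split on whether the last position `n + 1` lies in the set. Adding it to a set raises `setMaj`
by `n + 1` if `n` is absent and by nothing otherwise; the sets without `n` are counted by `ballotGF
n k`. The hypothesis is the ballot condition on the full word. -/
theorem ballotGF_three_term {n k : ℕ} (h : 2 * k ≤ n) :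
    ballotGF (n + 2) (k + 1) = ballotGF (n + 1) (k + 1) + ballotGF (n + 1) k
      + (X ^ (n + 1) - 1) * ballotGF n k := by
  have hinj : Set.InjOn (insert (n + 1)) (ballotSets (n + 1) k : Set (Finset ℕ)) := by
    intro S hS T hT hST
    have hS' : n + 1 ∉ S := fun h => by simpa using (mem_ballotSets.1 hS).1 h
    have hT' : n + 1 ∉ T := fun h => by simpa using (mem_ballotSets.1 hT).1 h
    rw [← erase_insert hS', ← erase_insert hT', hST]
  have e1 : ballotGF (n + 2) (k + 1) = ballotGF (n + 1) (k + 1)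
      + ∑ S ∈ ballotSets (n + 1) k, X ^ setMaj (insert (n + 1) S) := by
    rw [ballotGF, ← sum_filter_not_add_sum_filter _ (fun S => n + 1 ∈ S),
      ballotSets_filter_notMem, ballotSets_filter_mem (by omega), sum_image hinj, ballotGF]
  have e2 : ∑ S ∈ ballotSets (n + 1) k, (X : ℤ[X]) ^ setMaj (insert (n + 1) S)
      = ∑ S ∈ (ballotSets (n + 1) k).filter (fun S => n ∈ S), X ^ setMaj S
        + X ^ (n + 1) * ballotGF n k := by
    rw [← sum_filter_add_sum_filter_not _ (fun S => n ∈ S), ballotSets_filter_notMem, ballotGF,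
      mul_sum]
    congr 1
    · refine sum_congr rfl fun S hS => ?_
      rw [mem_filter, mem_ballotSets] at hS
      rw [setMaj_insert_of_mem hS.1.1 hS.2]
    · refine sum_congr rfl fun S hS => ?_
      rw [← ballotSets_filter_notMem, mem_filter, mem_ballotSets] at hS
      rw [setMaj_insert_of_notMem hS.1.1 hS.2, pow_add]
  have e3 : ballotGF (n + 1) k
      = ∑ S ∈ (ballotSets (n + 1) k).filter (fun S => n ∈ S), X ^ setMaj S + ballotGF n k := by
    rw [ballotGF, ← sum_filter_add_sum_filter_not _ (fun S => n ∈ S), ballotSets_filter_notMem,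
      ballotGF]
  linear_combination e1 + e2 - e3

/-- The range extends one step past the ballot bound because the recurrence reaches `2 * k = n + 1`;
there both sides vanish, the right one by symmetry of the `q`-binomial. -/
theorem ballotGF_eq_qBinomDiff : ∀ n k : ℕ, 2 * k ≤ n + 1 → ballotGF n k = qBinomDiff n k
  | n, 0, _ => by rw [ballotGF_zero, qBinomDiff, qBinom]
  | 0, k + 1, h => by omega
  | 1, k + 1, h => by
    obtain rfl : k = 0 := by omega
    rw [ballotGF, ballotSets_eq_empty (by omega), sum_empty]
    exact (qBinomDiff_eq_zero 0).symm
  | n + 2, k + 1, h => by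
    rcases Nat.lt_or_ge n (2 * k) with h' | h'
    · rw [show n + 2 = 2 * k + 1 by omega]
      rw [ballotGF, ballotSets_eq_empty (by omega), sum_empty, qBinomDiff_eq_zero]
    · rw [ballotGF_three_term h', qBinomDiff_three_term,
        ballotGF_eq_qBinomDiff (n + 1) (k + 1) (by omega),
        ballotGF_eq_qBinomDiff (n + 1) k (by omega), ballotGF_eq_qBinomDiff n k (by omega)]

end Ballot

end PermStat

namespace PermStat

/-! ### Non-nested involutions and their deficiencies -/

section Involution

variable {α : Type*} [LinearOrder α]

/-- The arcs `{i, π i}` of the involution `π` are pairwise non-nested, and no fixed point of `π`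
lies under an arc. -/
structure NonNested (π : Equiv.Perm α) : Prop where
  lt_of_lt : ∀ ⦃i j⦄, π i < i → π j < j → i < j → π i < π j
  not_under : ∀ ⦃i j⦄, π i = i → π j < i → ¬ i < j

/-- The middle entry of a 321 pattern decides: a deficiency or an excedance there gives two nested
arcs, a fixed point there lies under an arc. -/
theorem NonNested.not_lt_lt {π : Equiv.Perm α} (h : NonNested π) (hπ : Function.Involutive π)
    {i j k : α} (hij : i < j) (hjk : j < k) (h1 : π j < π i) (h2 : π k < π j) : False := by
  rcases lt_trichotomy (π j) j with hj | hj | hj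
  · exact lt_asymm h2 (h.lt_of_lt hj (h2.trans (hj.trans hjk)) hjk)
  · rw [hj] at h1
    exact h.not_under hj (by rwa [hπ i]) h1
  · have h3 := h.lt_of_lt (i := π j) (j := π i) (by rwa [hπ j])
      (by rw [hπ i]; exact hij.trans (hj.trans h1)) h1
    rw [hπ, hπ] at h3
    exact lt_asymm h3 hij

theorem nonNested_of_not_lt_lt {π : Equiv.Perm α} (hπ : Function.Involutive π)
    (h : ∀ i j k, i < j → j < k → π j < π i → π k < π j → False) : NonNested π where
  lt_of_lt i j hi hj hij := by
    by_contra hc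
    have hlt : π j < π i := lt_of_le_of_ne (not_lt.1 hc) fun e => hij.ne' (π.injective e)
    exact h (π j) i j (hlt.trans hi) hij (by rw [hπ j]; exact hi.trans hij) hlt
  not_under i j hi hj hij :=
    h (π j) i j hj hij (by rw [hπ j, hi]; exact hij) (by rwa [hi])

/-- If `π c < σ c`, then `σ c` is not a deficiency of `π`, nor fixed, since it would lie under the
arc of `c`. So `π` joins it to a larger point: before `c` this nests, at `c` it contradicts `π c < σ
c`, and after `c` the agreement with `σ` contradicts injectivity. -/
theorem NonNested.le_of_agree {π σ : Equiv.Perm α} (h : NonNested π) (hπ : Function.Involutive π)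
    (hσ : Function.Involutive σ) (hd : ∀ i, π i < i ↔ σ i < i) {c : α} (hc : π c < c)
    (hag : ∀ d, c < d → π d < d → π d = σ d) : σ c ≤ π c := by
  by_contra! hlt
  have hc' := (hd c).1 hc
  have hnot : ¬ π (σ c) < σ c := by
    rw [hd, hσ c]; exact hc'.not_gt
  have hne : π (σ c) ≠ σ c := fun e => h.not_under e hlt hc'
  have hgt : σ c < π (σ c) := lt_of_le_of_ne (not_lt.1 hnot) hne.symm
  have hdown : π (π (σ c)) < π (σ c) := by rwa [hπ]
  rcases lt_trichotomy (π (σ c)) c with hd' | hd' | hd'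
  · have := h.lt_of_lt hdown hc hd'
    rw [hπ] at this
    exact lt_asymm this hlt
  · rw [← hd', hπ, hd'] at hlt
    exact lt_irrefl _ hlt
  · have := hag _ hd' hdown
    rw [hπ] at this
    exact hd'.ne (σ.injective this)

theorem NonNested.ext_of_deficiency [Finite α] {π σ : Equiv.Perm α} (h : NonNested π)
    (h' : NonNested σ)
    (hπ : Function.Involutive π) (hσ : Function.Involutive σ) (hd : ∀ i, π i < i ↔ σ i < i) :
    π = σ := by
  have key : ∀ c, π c < c → π c = σ c := by
    intro c
    induction c using (Finite.to_wellFoundedGT (α := α)).wf.induction with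
    | _ c ih =>
    intro hc
    refine le_antisymm ?_ (h.le_of_agree hπ hσ hd hc fun d hcd hd' => ih d hcd hd')
    refine h'.le_of_agree hσ hπ (fun i => (hd i).symm) ((hd c).1 hc) fun d hcd hd' => ?_
    exact (ih d hcd ((hd d).2 hd')).symm
  ext i
  rcases lt_trichotomy (π i) i with hi | hi | hi
  · exact key i hi
  · rcases lt_trichotomy (σ i) i with hi' | hi' | hi'
    · exact key i ((hd i).2 hi')
    · rw [hi, hi']
    · have := key (σ i) ((hd _).2 (by rwa [hσ]))
      rw [hσ] at this
      exact absurd (π.injective (this.trans hi.symm)) hi'.ne'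
  · have := key (π i) (by rwa [hπ])
    rw [hπ] at this
    exact σ.injective (by rw [← this, hσ])

/-- Matching each letter of `S` with a letter of `U` preceding it, from right to left, each time
with the last one available. -/
theorem exists_matching (S : Finset α) : ∀ U : Finset α, Disjoint U S →
    (∀ j, #(S.filter (· ≤ j)) ≤ #(U.filter (· ≤ j))) →
    ∃ π : Equiv.Perm α, Function.Involutive π ∧ (∀ i, i ∉ U → i ∉ S → π i = i) ∧
      (∀ i ∈ S, π i < i ∧ π i ∈ U) ∧ (∀ i ∈ U, π i = i ∨ π i ∈ S) ∧ StrictMonoOn π S ∧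
      ∀ i ∈ U, π i = i → ∀ j ∈ S, π j < i → ¬ i < j := by
  induction S using Finset.induction_on_max with
  | empty =>
    intro U _ _
    exact ⟨1, fun _ => rfl, by simp, by simp, by simp, fun _ _ _ _ h => h, by simp⟩
  | insert c S hS ih =>
    intro U hU hball
    rw [disjoint_insert_right] at hU
    obtain ⟨hcU, hUS⟩ := hU
    have hcS : c ∉ S := fun h => lt_irrefl _ (hS c h)
    have hballc := hball c
    rw [filter_true_of_mem (s := insert c S) (by
      intro x hx
      rcases mem_insert.1 hx with rfl | hx
      · exact le_rfl
      · exact (hS x hx).le), card_insert_of_notMem hcS] at hballc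
    have hne : (U.filter (· ≤ c)).Nonempty := card_pos.1 (by omega)
    obtain ⟨u, hu, hmax⟩ := exists_max_image _ id hne
    rw [mem_filter] at hu
    have huc : u < c := lt_of_le_of_ne hu.2 fun e => hcU (e ▸ hu.1)
    have huS : u ∉ S := fun h => disjoint_left.1 hUS hu.1 h
    have hmax' : ∀ i ∈ U, i ≤ c → i ≤ u := fun i hi hic => hmax i (mem_filter.2 ⟨hi, hic⟩)
    have herase : ∀ j, u ≤ j → #((U.erase u).filter (· ≤ j)) + 1 = #(U.filter (· ≤ j)) := by
      intro j hj
      rw [filter_erase]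
      exact card_erase_add_one (mem_filter.2 ⟨hu.1, hj⟩)
    obtain ⟨π, hπ, hfix, hdef, hexc, hmono, hund⟩ := ih (U.erase u)
      (hUS.mono_left (erase_subset _ _)) (by
        intro j
        rcases lt_or_ge j u with hj | hj
        · rw [filter_erase, erase_eq_of_notMem (by simp [hj])]
          refine le_trans (card_le_card ?_) (hball j)
          exact filter_subset_filter _ (subset_insert _ _)
        · have h1 := herase j hj
          rcases lt_or_ge j c with hjc | hjc
          · have h2 : #(S.filter (· ≤ j)) ≤ #S := card_le_card (filter_subset _ _)
            -- `u` is the last point of `U` up to `c`, so the prefix at `j` already holds all the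
            -- points counted at `c`, enough to spare `u`.
            have h3 : U.filter (· ≤ c) = U.filter (· ≤ j) := by
              ext i
              simp only [mem_filter]
              exact ⟨fun ⟨a, b⟩ => ⟨a, (hmax' i a b).trans hj⟩, fun ⟨a, b⟩ => ⟨a, b.trans hjc.le⟩⟩
            rw [h3] at hballc
            omega
          · have h2 := hball j
            rw [filter_insert, if_pos hjc,
              card_insert_of_notMem (fun h => hcS (mem_filter.1 h).1)] at h2
            omega)
    have hπu : π u = u := hfix u (by simp) huS
    have hπc : π c = c := hfix c (by simp [hcU]) hcS
    have hval : ∀ i, i ≠ u → i ≠ c → (π * Equiv.swap u c) i = π i := fun i h1 h2 => by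
      rw [Equiv.Perm.mul_apply, Equiv.swap_apply_of_ne_of_ne h1 h2]
    have hvalu : (π * Equiv.swap u c) u = c := by simp [hπc]
    have hvalc : (π * Equiv.swap u c) c = u := by simp [hπu]
    have hneS : ∀ i ∈ S, i ≠ u ∧ i ≠ c := fun i hi =>
      ⟨fun e => huS (e ▸ hi), fun e => hcS (e ▸ hi)⟩
    have hπlt : ∀ i ∈ S, π i < u := fun i hi => by
      obtain ⟨h1, h2⟩ := hdef i hi
      exact lt_of_le_of_ne (hmax' _ (mem_of_mem_erase h2) (h1.trans (hS i hi)).le)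
        (ne_of_mem_erase h2)
    refine ⟨π * Equiv.swap u c, ?_, ?_, ?_, ?_, ?_, ?_⟩
    · intro i
      rcases eq_or_ne i u with rfl | h1
      · rw [hvalu, hvalc]
      rcases eq_or_ne i c with rfl | h2
      · rw [hvalc, hvalu]
      rw [hval i h1 h2, hval _ (fun e => h1 (π.injective (e.trans hπu.symm)))
        (fun e => h2 (π.injective (e.trans hπc.symm))), hπ]
    · intro i h1 h2
      rw [mem_insert, not_or] at h2
      have h3 : i ≠ u := fun e => h1 (e ▸ hu.1)
      rw [hval i h3 h2.1, hfix i (fun h => h1 (mem_of_mem_erase h)) h2.2]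
    · intro i hi
      rcases mem_insert.1 hi with rfl | hi
      · rw [hvalc]; exact ⟨huc, hu.1⟩
      · rw [hval i (hneS i hi).1 (hneS i hi).2]
        exact ⟨(hdef i hi).1, mem_of_mem_erase (hdef i hi).2⟩
    · intro i hi
      rcases eq_or_ne i u with rfl | h1
      · rw [hvalu]; exact Or.inr (mem_insert_self _ _)
      · rw [hval i h1 (fun e => hcU (e ▸ hi))]
        exact (hexc i (mem_erase.2 ⟨h1, hi⟩)).imp id (mem_insert_of_mem)
    · intro i hi j hj hij
      rcases mem_insert.1 (mem_coe.1 hi) with rfl | hi'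
      · rcases mem_insert.1 (mem_coe.1 hj) with rfl | hj
        · exact absurd hij (lt_irrefl _)
        · exact absurd hij (hS j hj).not_gt
      · rw [hval i (hneS i hi').1 (hneS i hi').2]
        rcases mem_insert.1 (mem_coe.1 hj) with rfl | hj
        · rw [hvalc]; exact hπlt i hi'
        · rw [hval j (hneS j hj).1 (hneS j hj).2]
          exact hmono hi' hj hij
    · intro i hi hii j hj hji hij
      have h1 : i ≠ u := by
        rintro rfl
        exact huc.ne' (hvalu.symm.trans hii)
      rw [hval i h1 (fun e => hcU (e ▸ hi))] at hii
      rcases mem_insert.1 hj with rfl | hj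
      · rw [hvalc] at hji
        exact hji.not_ge (hmax' i hi hij.le)
      · rw [hval j (hneS j hj).1 (hneS j hj).2] at hji
        exact hund i (mem_erase.2 ⟨h1, hi⟩) hii j hj hji hij

theorem exists_nonNested [Fintype α] (S : Finset α)
    (hball : ∀ j, #(S.filter (· ≤ j)) ≤ #(Sᶜ.filter (· ≤ j))) :
    ∃ π : Equiv.Perm α, Function.Involutive π ∧ NonNested π ∧ ∀ i, π i < i ↔ i ∈ S := by
  obtain ⟨π, hπ, -, hdef, hexc, hmono, hund⟩ :=
    exists_matching S Sᶜ disjoint_compl_left hball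
  have hiff : ∀ i, π i < i ↔ i ∈ S := by
    refine fun i => ⟨fun hi => ?_, fun hi => (hdef i hi).1⟩
    by_contra hc
    rcases hexc i (mem_compl.2 hc) with h | h
    · exact hi.ne h
    · have := (hdef _ h).1
      rw [hπ] at this
      exact lt_asymm this hi
  refine ⟨π, hπ, ⟨fun i j hi hj hij => ?_, fun i j hi hji hij => ?_⟩, hiff⟩
  · exact hmono ((hiff i).1 hi) ((hiff j).1 hj) hij
  · exact hund i (mem_compl.2 fun h => ((hiff i).2 h).ne hi) hi j
      ((hiff j).1 (hji.trans hij)) hji hij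

/-- `π` injects the deficiencies before `j` into the non-deficiencies before `j`. -/
theorem card_deficiency_le [Fintype α] {π : Equiv.Perm α} (hπ : Function.Involutive π) (j : α) :
    2 * #(univ.filter fun i => π i < i ∧ i < j) ≤ #(univ.filter (· < j)) := by
  have h1 : #(univ.filter fun i => π i < i ∧ i < j) ≤ #(univ.filter fun i => ¬ π i < i ∧ i < j) := by
    refine card_le_card_of_injOn π (fun i hi => ?_) π.injective.injOn
    simp only [coe_filter, mem_univ, true_and, Set.mem_ofPred_eq] at hi ⊢
    rw [hπ]
    exact ⟨hi.1.not_gt, hi.1.trans hi.2⟩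
  have h2 := card_filter_add_card_filter_not (s := univ.filter (· < j)) (fun i => π i < i)
  simp only [filter_filter, and_comm] at h1 h2 ⊢
  omega

end Involution

/-! ### The bijection with ballot sets and its statistics -/

section Deficiency

variable {n : ℕ}

theorem mem_involutions321 {π : Equiv.Perm (Fin n)} :
    π ∈ involutions321 n ↔ Function.Involutive π ∧ NonNested π := by
  simp only [involutions321, mem_filter, mem_univ, true_and]
  refine and_congr_right fun hπ => ⟨fun h => ?_, fun h => ?_⟩
  · refine nonNested_of_not_lt_lt hπ fun i j k hij hjk h1 h2 => h ⟨![i, j, k], ?_, ?_⟩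
    · rw [Fin.strictMono_iff_lt_succ]
      intro a
      fin_cases a
      · exact hij
      · exact hjk
    · intro s t
      have h3 := h2.trans h1
      fin_cases s <;> fin_cases t <;>
        simp [pattern321, h1, h2, h3, h1.le, h2.le, h3.le]
  · rintro ⟨f, hf, hf'⟩
    refine h.not_lt_lt hπ (hf (show (0 : Fin 3) < 1 by decide))
      (hf (show (1 : Fin 3) < 2 by decide)) ((hf' _ _).2 ?_) ((hf' _ _).2 ?_) <;> decide

/-- The deficiencies of a permutation: the positions whose value is smaller. -/
def deficiencies (π : Equiv.Perm (Fin n)) : Finset ℕ :=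
  (univ.filter fun i => π i < i).map Fin.valEmbedding

theorem mem_deficiencies {π : Equiv.Perm (Fin n)} (i : Fin n) :
    (i : ℕ) ∈ deficiencies π ↔ π i < i := by
  simp [deficiencies, Fin.val_inj]

theorem deficiencies_subset (π : Equiv.Perm (Fin n)) : deficiencies π ⊆ range n := by
  intro x hx
  obtain ⟨i, -, rfl⟩ := mem_map.1 hx
  exact mem_range.2 i.2

theorem fp_add_card_deficiencies {π : Equiv.Perm (Fin n)} (hπ : Function.Involutive π) :
    fp π + 2 * #(deficiencies π) = n := by
  have h1 : #(univ.filter fun i => i < π i) = #(univ.filter fun i => π i < i) := by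
    refine card_nbij' π π ?_ ?_ (fun i _ => hπ i) (fun i _ => hπ i) <;>
    · intro i hi
      simpa [hπ i] using hi
  have h2 : #(univ.filter fun i => π i < i) + #(univ.filter fun i => ¬ π i < i) = n := by
    rw [card_filter_add_card_filter_not]; simp
  have h3 := card_filter_add_card_filter_not (s := univ.filter fun i => ¬ π i < i)
    (fun i => π i = i)
  have h4 : (univ.filter fun i => ¬ π i < i).filter (fun i => π i = i)
      = univ.filter fun i => π i = i := by
    ext i; simp +contextual
  have h5 : (univ.filter fun i => ¬ π i < i).filter (fun i => ¬ π i = i)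
      = univ.filter fun i => i < π i := by
    ext i
    simp only [mem_filter, mem_univ, true_and, not_lt]
    exact ⟨fun h => lt_of_le_of_ne h.1 (Ne.symm h.2), fun h => ⟨h.le, h.ne'⟩⟩
  rw [h4, h5] at h3
  rw [fp, deficiencies, card_map]
  omega

theorem ballot_deficiencies {π : Equiv.Perm (Fin n)} (hπ : Function.Involutive π) :
    Ballot (deficiencies π) := by
  intro j
  rcases lt_or_ge j n with hj | hj
  · have h := card_deficiency_le hπ ⟨j, hj⟩
    have h1 : #(univ.filter (· < (⟨j, hj⟩ : Fin n))) = j := by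
      rw [filter_gt_eq_Iio, Fin.card_Iio]
    rw [h1] at h
    rw [deficiencies, filter_map, card_map, filter_filter]
    exact h
  · have h := fp_add_card_deficiencies hπ
    have := card_le_card (filter_subset (· < j) (deficiencies π))
    omega

/-- The 1-based descent `p` compares the 0-based positions `p - 1` and `p`. At a descent the lower
entry must be a deficiency, by 321-avoidance, and the upper one cannot be, as deficiencies have
increasing values. Conversely, an ascent into a deficiency from a non-deficiency would squeeze a
value strictly between `p - 1` and `p`. -/
theorem setMaj_deficiencies {π : Equiv.Perm (Fin n)} (hπ : Function.Involutive π)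
    (h : NonNested π) : setMaj (deficiencies π) = maj π := by
  rw [setMaj, maj]
  refine sum_congr ?_ fun _ _ => rfl
  ext p
  simp only [mem_filter, descents, mem_Ico]
  constructor
  · rintro ⟨hp, hp'⟩
    have hpn := mem_range.1 (deficiencies_subset π hp)
    -- Truncated subtraction makes `0` its own predecessor, so the filter excludes it.
    have hp0 : p ≠ 0 := by
      rintro rfl
      exact hp' hp
    have h1 := (mem_deficiencies (π := π) ⟨p, hpn⟩).1 hp
    have h2 := mt (mem_deficiencies (π := π) ⟨p - 1, by omega⟩).2 hp'
    refine ⟨⟨by omega, hpn⟩, ⟨p - 1, by omega⟩, ⟨p, hpn⟩, by simp; omega, rfl, ?_⟩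
    by_contra h3
    have h4 : π ⟨p - 1, by omega⟩ ≠ π ⟨p, hpn⟩ := fun e => by
      have := Fin.val_eq_of_eq (π.injective e)
      simp at this
      omega
    have h5 := lt_of_le_of_ne (not_lt.1 h3) h4
    have h6 : π ⟨p - 1, by omega⟩ = ⟨p - 1, by omega⟩ := by
      rw [Fin.lt_def] at h1 h2 h5
      simp only at h1 h2
      ext
      simp only
      omega
    rw [h6, Fin.lt_def] at h5
    rw [Fin.lt_def] at h1
    simp only at h1 h5
    omega
  · rintro ⟨⟨hp1, hpn⟩, i, j, hi, hj, hij⟩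
    have hlt : i < j := by rw [Fin.lt_def]; omega
    have hj' : π j < j := by
      by_contra hc
      rcases eq_or_lt_of_le (not_lt.1 hc) with e | e
      · exact h.not_under e.symm (by rwa [hπ i]) (by rwa [← e] at hij)
      · refine h.not_lt_lt hπ hlt e hij ?_
        rwa [hπ j]
    have hi' : ¬ π i < i := fun hi' => lt_asymm hij (h.lt_of_lt hi' hj' hlt)
    rw [← hj, show (j : ℕ) - 1 = i by omega, mem_deficiencies, mem_deficiencies]
    exact ⟨hj', hi'⟩

theorem exists_deficiencies_eq {S : Finset ℕ} (hS : S ⊆ range n) (h : Ballot S) :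
    ∃ π ∈ involutions321 n, deficiencies π = S := by
  obtain ⟨π, hπ, hnn, hd⟩ := exists_nonNested (univ.filter fun i : Fin n => (i : ℕ) ∈ S) (by
    intro j
    -- `Ballot` uses strict prefixes, the matching inclusive ones.
    have h1 := h (j + 1)
    have h2 : #((univ.filter fun i : Fin n => (i : ℕ) ∈ S).filter (· ≤ j))
        = #(S.filter (· < (j : ℕ) + 1)) := by
      rw [← card_map Fin.valEmbedding]
      congr 1
      ext x
      simp only [mem_map, mem_filter, mem_univ, true_and, Fin.valEmbedding_apply]
      constructor
      · rintro ⟨i, ⟨hi, hij⟩, rfl⟩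
        exact ⟨hi, Nat.lt_succ_of_le hij⟩
      · rintro ⟨hx, hxj⟩
        exact ⟨⟨x, mem_range.1 (hS hx)⟩, ⟨hx, Nat.le_of_lt_succ hxj⟩, rfl⟩
    have h3 := card_filter_add_card_filter_not (s := univ.filter (· ≤ j))
      (fun i : Fin n => (i : ℕ) ∈ S)
    rw [show #(univ.filter (· ≤ j)) = (j : ℕ) + 1 by rw [filter_ge_eq_Iic, Fin.card_Iic],
      filter_filter, filter_filter] at h3
    rw [← h2, filter_filter] at h1
    rw [compl_filter, filter_filter, filter_filter]
    simp only [and_comm] at h1 h3 ⊢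
    omega)
  refine ⟨π, mem_involutions321.2 ⟨hπ, hnn⟩, ?_⟩
  ext x
  constructor
  · intro hx
    obtain ⟨i, hi, rfl⟩ := mem_map.1 hx
    simpa using (hd i).1 (mem_filter.1 hi).2
  · intro hx
    have hxn := mem_range.1 (hS hx)
    exact (mem_deficiencies (π := π) ⟨x, hxn⟩).2 ((hd _).2 (by simpa using hx))

open Polynomial

theorem sum_involutions321 (n k : ℕ) :
    ∑ π ∈ (involutions321 n).filter (fun π => #(deficiencies π) = k), (X : ℤ[X]) ^ maj π
      = ballotGF n k := by
  refine sum_nbij deficiencies ?_ ?_ ?_ ?_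
  · intro π hπ
    rw [mem_filter, mem_involutions321] at hπ
    exact mem_ballotSets.2 ⟨deficiencies_subset π, hπ.2, ballot_deficiencies hπ.1.1⟩
  · intro π hπ σ hσ h
    rw [mem_coe, mem_filter, mem_involutions321] at hπ hσ
    refine hπ.1.2.ext_of_deficiency hσ.1.2 hπ.1.1 hσ.1.1 fun i => ?_
    rw [← mem_deficiencies, ← mem_deficiencies, h]
  · intro S hS
    obtain ⟨h1, h2, h3⟩ := mem_ballotSets.1 (mem_coe.1 hS)
    obtain ⟨π, hπ, rfl⟩ := exists_deficiencies_eq h1 h3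
    exact ⟨π, mem_coe.2 (mem_filter.2 ⟨hπ, h2⟩), rfl⟩
  · intro π hπ
    rw [mem_filter, mem_involutions321] at hπ
    rw [setMaj_deficiencies hπ.1.1 hπ.1.2]

end Deficiency

end PermStat

/-! ### The two identities -/

theorem corollary6p3 :
    (∀ a b : ℕ, a ≤ b →
      ∑ π ∈ (PermStat.involutions321 (a + b)).filter (fun π => b - a ≤ PermStat.fp π),
          (Polynomial.X : Polynomial ℤ) ^ PermStat.maj π
        = PermStat.qBinom (a + b) a) ∧
    (∀ n l : ℕ, l ≡ n [MOD 2] →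
      ∑ π ∈ (PermStat.involutions321 n).filter (fun π => PermStat.fp π = l),
          (Polynomial.X : Polynomial ℤ) ^ PermStat.maj π
        = PermStat.qBinomInt n (((n : ℤ) - l) / 2)
          - PermStat.qBinomInt n (((n : ℤ) - l) / 2 - 1)) := by
  open PermStat in
  have hfp : ∀ {n : ℕ} {π : Equiv.Perm (Fin n)}, π ∈ involutions321 n →
      fp π + 2 * #(deficiencies π) = n := fun hπ =>
    fp_add_card_deficiencies (mem_involutions321.1 hπ).1
  constructor
  · intro a b hab
    rw [← sum_qBinomDiff, ← sum_fiberwise_of_maps_to (t := range (a + 1))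
      (g := fun π => #(deficiencies π))]
    · refine sum_congr rfl fun k hk => ?_
      have hk := mem_range.1 hk
      -- With `k` deficiencies `fp π = a + b - 2 * k`, so `k ≤ a` already forces the bound on `fp`.
      rw [← ballotGF_eq_qBinomDiff _ _ (by omega), ← sum_involutions321, filter_filter]
      refine sum_congr (filter_congr fun π hπ => ?_) fun _ _ => rfl
      have := hfp hπ
      omega
    · intro π hπ
      rw [mem_filter] at hπ
      have := hfp hπ.1
      rw [mem_range]
      omega
  · intro n l hl
    rcases le_or_gt l n with h | h
    · obtain ⟨k, hk⟩ : ∃ k, n = l + 2 * k := by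
        refine ⟨(n - l) / 2, ?_⟩
        have : l % 2 = n % 2 := hl
        omega
      rw [show ((n : ℤ) - l) / 2 = (k : ℕ) by omega, qBinomInt_sub,
        ← ballotGF_eq_qBinomDiff _ _ (by omega), ← sum_involutions321]
      refine sum_congr (filter_congr fun π hπ => ?_) fun _ _ => rfl
      have := hfp hπ
      omega
    · rw [filter_false_of_mem (fun π hπ => by have := hfp hπ; omega), sum_empty]
      have : l % 2 = n % 2 := hl
      -- For `l > n` equal parity makes `n - l` at most `-2`, so both lower indices are negative.
      obtain ⟨k, hk⟩ : ∃ k : ℕ, ((n : ℤ) - l) / 2 = Int.negSucc k :=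
        ⟨(l - n) / 2 - 1, by rw [Int.negSucc_eq]; omega⟩
      rw [hk, show Int.negSucc k - 1 = Int.negSucc (k + 1) by
        rw [Int.negSucc_eq, Int.negSucc_eq]; push_cast; ring]
      simp [qBinomInt]
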